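/- **Conventions.** A *unital locally $C^*$-algebra* is a unital complex $*$-algebra $\mathscr A$ which is complete and Hausdorff in the topology generated by the set $\Delta=S(\mathscr A)$ of all its continuous $C^*$-seminorms; $\Delta$, ordered pointwise, is upward directed. A *Hilbert $\mathscr A$-module* is a right $\mathscr A$-module $\mathcal M$ with an $\mathscr A$-valued inner product, $\mathbb C$- and $\mathscr A$-linear in the second variable, with $\langle y,x\rangle=\langle x,y\rangle^*$, $\langle x,x\rangle\ge 0$, and $\langle x,x\rangle=0$ only for $x=0$, which is complete in the topology of the seminorms $\|x\|_p=p(\langle x,x\rangle)^{1/2}$, $p\in\Delta$. A *locally Hilbert space* over $\Delta$ is a union $\mathcal H=\bigcup_{\alpha\in\Delta}\mathcal H_\alpha$ of Hilbert spaces with $\mathcal H_\alpha$ a closed subspace of $\mathcal H_\beta$ for $\alpha\le\beta$, with the finest locally convex topology that makes all inclusions $\mathcal H_\alpha\to\mathcal H$ continuous; $[Y]$ is the closed linear span of $Y$ in this topology. For locally Hilbert spaces $\mathcal H,\mathcal K$ over $\Delta$, $\mathscr L(\mathcal H,\mathcal K)$ is the set of linear maps $T:\mathcal H\to\mathcal K$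 which restrict to bounded operators $T_\alpha:\mathcal H_\alpha\to\mathcal K_\alpha$ for all $\alpha$ and commute with the orthogonal projections onto $\mathcal H_\alpha$ and $\mathcal K_\alpha$, with the topology of the seminorms $T\mapsto\|T_\alpha\|$; the adjoint $T^*\in\mathscr L(\mathcal K,\mathcal H)$ is given by $T^*|_{\mathcal K_\alpha}=(T_\alpha)^*$. Put $\mathscr L(\mathcal H)=\mathscr L(\mathcal H,\mathcal H)$, a unital $*$-algebra. A linear map between such algebras is *completely positive* if, for every $k$, its entrywise amplification to $k\times k$ matrices maps every $a^*a$ to a positive element (one of the form $c^*c$). A matrix $(\varphi_{ij})_{i,j=1}^n$ of linear maps $\mathscr A\to\mathscr L(\mathcal H)$ is a *continuous completely $n$-positive map* if $[\varphi]:\mathbb M_n(\mathscr A)\to\mathbb M_n(\mathscr L(\mathcal H))$, $(a_{ij})\mapsto(\varphi_{ij}(a_{ij}))$, is continuous and completely positive. A matrix $[\Phi]=(\Phi_{ij})_{i,j=1}^n$ of continuous linear maps $\Phi_{ij}:\mathcal M\to\mathscr L(\mathcal H,\mathcal K)$ is *$[\varphi]$-completely positive* if $[\varphi]$ is a continuous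 completely $n$-positive map and $\sum_{r=1}^n\Phi_{ri}(x)^*\Phi_{rj}(y)=\varphi_{ij}(\langle x,y\rangle)$ for all $x,y\in\mathcal M$ and all $i,j$. **Theorem.** Let $\mathscr A$ be a unital locally $C^*$-algebra, $\mathcal M$ a Hilbert $\mathscr A$-module, $\mathcal H$ and $\mathcal K$ locally Hilbert spaces over $\Delta=S(\mathscr A)$, $[\varphi]=(\varphi_{ij})_{i,j=1}^n$ a continuous completely $n$-positive map from $\mathscr A$ to $\mathscr L(\mathcal H)$, and $[\Phi]=(\Phi_{ij})_{i,j=1}^n$ a $[\varphi]$-completely positive matrix of continuous linear maps $\Phi_{ij}:\mathcal M\to\mathscr L(\mathcal H,\mathcal K)$. Then there are locally Hilbert spaces $\mathcal H^\Phi,\mathcal K^\Phi$ over $\Delta$, a continuous unital $*$-homomorphism $\pi^\varphi:\mathscr A\to\mathscr L(\mathcal H^\Phi)$, a continuous linear map $\pi^\Phi:\mathcal M\to\mathscr L(\mathcal H^\Phi,\mathcal K^\Phi)$ with $\pi^\Phi(x)^*\pi^\Phi(y)=\pi^\varphi(\langle x,y\rangle)$ for all $x,y\in\mathcal M$, and continuous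 operators $S_i\in\mathscr L(\mathcal H,\mathcal H^\Phi)$, $W_i\in\mathscr L(\mathcal K,\mathcal K^\Phi)$ ($i=1,\dots,n$) such that 1. $\varphi_{ij}(a)=S_i^*\,\pi^\varphi(a)\,S_j$ for all $a\in\mathscr A$ and all $i,j$; 2. $\Phi_{ij}(x)=W_i^*\,\pi^\Phi(x)\,S_j$ for all $x\in\mathcal M$ and all $i,j$; 3. $\mathcal H^\Phi=[\{\pi^\varphi(a)S_i\xi:\ a\in\mathscr A,\ \xi\in\mathcal H,\ 1\le i\le n\}]$; 4. $\mathcal K^\Phi=[\{\pi^\Phi(x)S_i\xi:\ x\in\mathcal M,\ \xi\in\mathcal H,\ 1\le i\le n\}]$. -/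

import Mathlib

universe u v w w₁ w₂

noncomputable section

open scoped InnerProductSpace Topology

/-! ### Locally C*-algebras -/

/-- A continuous C*-seminorm on a topological `*`-algebra over `ℂ`. The type
`CStarSeminorm A` is the set `S(A)` of all of them. -/
structure CStarSeminorm (A : Type u) [Ring A] [StarRing A] [Algebra ℂ A]
    [TopologicalSpace A] where
  toSeminorm : Seminorm ℂ A
  continuous_toSeminorm : Continuous toSeminorm
  mul_le : ∀ a b : A, toSeminorm (a * b) ≤ toSeminorm a * toSeminorm b
  star_mul_self : ∀ a : A, toSeminorm (star a * a) = toSeminorm a ^ 2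

namespace CStarSeminorm

variable {A : Type u} [Ring A] [StarRing A] [Algebra ℂ A] [TopologicalSpace A]

instance : CoeFun (CStarSeminorm A) (fun _ => A → ℝ) := ⟨fun p => p.toSeminorm⟩

/-- Pointwise order: `p ≤ q` iff `p a ≤ q a` for all `a`. -/
instance : Preorder (CStarSeminorm A) := Preorder.lift toSeminorm

/-- The maximum of two continuous C*-seminorms is one; hence `S(A)` is upward directed. -/
instance : IsDirectedOrder (CStarSeminorm A) where
  directed p q := by
    have happ : ∀ a : A, (p.toSeminorm ⊔ q.toSeminorm) a = max (p a) (q a) := fun a => rfl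
    refine ⟨⟨p.toSeminorm ⊔ q.toSeminorm, ?_, ?_, ?_⟩, ?_, ?_⟩
    · exact p.continuous_toSeminorm.max q.continuous_toSeminorm
    · intro a b
      simp only [happ]
      refine max_le ((p.mul_le a b).trans ?_) ((q.mul_le a b).trans ?_)
      · exact mul_le_mul (le_max_left _ _) (le_max_left _ _) (apply_nonneg _ _)
          ((apply_nonneg p.toSeminorm a).trans (le_max_left _ _))
      · exact mul_le_mul (le_max_right _ _) (le_max_right _ _) (apply_nonneg _ _)
          ((apply_nonneg p.toSeminorm a).trans (le_max_left _ _))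
    · intro a
      simp only [happ, p.star_mul_self, q.star_mul_self]
      rcases le_total (p a) (q a) with h | h
      · rw [max_eq_right h, max_eq_right (pow_le_pow_left₀ (apply_nonneg _ _) h 2)]
      · rw [max_eq_left h, max_eq_left (pow_le_pow_left₀ (apply_nonneg _ _) h 2)]
    · exact (le_sup_left : p.toSeminorm ≤ p.toSeminorm ⊔ q.toSeminorm)
    · exact (le_sup_right : q.toSeminorm ≤ p.toSeminorm ⊔ q.toSeminorm)

end CStarSeminorm

/-- A unital complex `*`-algebra is a (unital) locally C*-algebra if it is complete, Hausdorff, and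
its topology is the one generated by its continuous C*-seminorms. As the maximum of two continuous
C*-seminorms is again one, the balls of the single seminorms form a basis at `0`. -/
class LocallyCStarAlgebra (A : Type u) [Ring A] [StarRing A] [Algebra ℂ A] [StarModule ℂ A]
    [UniformSpace A] [IsUniformAddGroup A] : Prop where
  complete : CompleteSpace A
  hausdorff : T2Space A
  hasBasis_nhds_zero : (𝓝 (0 : A)).HasBasis
    (fun b : CStarSeminorm A × ℝ => 0 < b.2) (fun b => {a : A | b.1 a < b.2})

/-- Positive elements of a locally C*-algebra: those of the form `c* c`. -/
def IsPositiveElement {B : Type*} [Mul B] [Star B] (b : B) : Prop := ∃ c : B, b = star c * c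

/-! ### Hilbert modules over locally C*-algebras -/

/-- A Hilbert `A`-module: a right `A`-module (a module over the opposite ring) with an `A`-valued
inner product, linear in the second variable, which is complete in the topology generated by the
seminorms `‖x‖_p = p(⟨x,x⟩)^(1/2)`, `p ∈ S(A)`. -/
class HilbertModule (A : Type u) (M : Type v) [Ring A] [StarRing A] [Algebra ℂ A] [StarModule ℂ A]
    [UniformSpace A] [IsUniformAddGroup A] [AddCommGroup M] [Module ℂ M] [Module Aᵐᵒᵖ M]
    [UniformSpace M] [IsUniformAddGroup M] extends Inner A M where
  inner_add_right : ∀ x y z : M, inner x (y + z) = inner x y + inner x z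
  inner_smul_right : ∀ (x y : M) (c : ℂ), inner x (c • y) = c • inner x y
  inner_op_smul_right : ∀ (x y : M) (a : A), inner x (MulOpposite.op a • y) = inner x y * a
  star_inner : ∀ x y : M, star (inner x y) = inner y x
  inner_self_pos : ∀ x : M, IsPositiveElement (inner x x)
  eq_zero_of_inner_self : ∀ x : M, inner x x = 0 → x = 0
  complete : CompleteSpace M
  hasBasis_nhds_zero : (𝓝 (0 : M)).HasBasis
    (fun b : CStarSeminorm A × ℝ => 0 < b.2) (fun b => {x : M | √(b.1 (inner x x)) < b.2})

/-! ### Locally Hilbert spaces -/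

/-- A locally Hilbert space: the union `H = ⋃ H_α` of an increasing family of Hilbert spaces, `H_α`
being a closed subspace of `H_β` for `α ≤ β`. The compatible inner products of the `H_α` amount to
one inner product on the union. The norm of `carrier` only records it; the topology of the locally
Hilbert space is `LocallyHilbertSpace.topology` below. -/
structure LocallyHilbertSpace (ι : Type u) [Preorder ι] [IsDirectedOrder ι] where
  carrier : Type w
  [normed : NormedAddCommGroup carrier]
  [innerProduct : InnerProductSpace ℂ carrier]
  level : ι → Submodule ℂ carrier
  level_mono : Monotone level
  [level_complete : ∀ α, CompleteSpace (level α)]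
  exists_mem_level : ∀ x : carrier, ∃ α, x ∈ level α

namespace LocallyHilbertSpace

variable {ι : Type u} [Preorder ι] [IsDirectedOrder ι]

instance : CoeSort (LocallyHilbertSpace.{u, w} ι) (Type w) := ⟨carrier⟩

attribute [instance] normed innerProduct level_complete

/-- The norm topology of the Hilbert space `H_α`. -/
@[reducible] def levelTopology (H : LocallyHilbertSpace.{u, w} ι) (α : ι) :
    TopologicalSpace (H.level α) := inferInstance

/-- The inductive limit topology: the finest locally convex vector space topology for which all the
inclusions `H_α → H` are continuous. -/
@[reducible] def topology (H : LocallyHilbertSpace.{u, w} ι) : TopologicalSpace H :=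
  sInf {τ : TopologicalSpace H | @IsTopologicalAddGroup H τ _ ∧ @ContinuousSMul ℂ H _ _ τ ∧
    @LocallyConvexSpace ℝ H _ _ _ _ τ ∧
    ∀ α, @Continuous (H.level α) H (H.levelTopology α) τ Subtype.val}

/-- `[Y]`: the closed subspace generated by `Y`, for the inductive limit topology. -/
def closedSpan (H : LocallyHilbertSpace.{u, w} ι) (Y : Set H) : Set H :=
  @closure H H.topology (Submodule.span ℂ Y : Set H)

variable {H : LocallyHilbertSpace.{u, w} ι} {K : LocallyHilbertSpace.{u, w₁} ι}
  {L : LocallyHilbertSpace.{u, w₂} ι}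

/-- The linear maps `T : H → K` that are limits of bounded operators `T_α : H_α → K_α` and satisfy
`R_α T = T P_α`, where `P_α` and `R_α` are the orthogonal projections onto `H_α` and `K_α`. -/
def opSubmodule (H : LocallyHilbertSpace.{u, w} ι) (K : LocallyHilbertSpace.{u, w₁} ι) :
    Submodule ℂ (H →ₗ[ℂ] K) where
  carrier := {T | (∀ α, ∀ x ∈ H.level α, T x ∈ K.level α) ∧
    (∀ α, ∃ C : ℝ, ∀ x ∈ H.level α, ‖T x‖ ≤ C * ‖x‖) ∧
    ∀ (α) (x : H), (K.level α).starProjection (T x) = T ((H.level α).starProjection x)}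
  add_mem' := by
    rintro T S ⟨h1, h2, h3⟩ ⟨k1, k2, k3⟩
    refine ⟨fun α x hx => (K.level α).add_mem (h1 α x hx) (k1 α x hx), fun α => ?_, fun α x => ?_⟩
    · obtain ⟨C, hC⟩ := h2 α
      obtain ⟨D, hD⟩ := k2 α
      refine ⟨C + D, fun x hx => ?_⟩
      rw [LinearMap.add_apply, add_mul]
      exact (norm_add_le _ _).trans (add_le_add (hC x hx) (hD x hx))
    · simp only [LinearMap.add_apply, map_add, h3, k3]
  zero_mem' := by
    refine ⟨fun α x _ => (K.level α).zero_mem, fun α => ⟨0, fun x _ => by simp⟩, fun α x => by simp⟩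
  smul_mem' := by
    rintro c T ⟨h1, h2, h3⟩
    refine ⟨fun α x hx => (K.level α).smul_mem c (h1 α x hx), fun α => ?_, fun α x => ?_⟩
    · obtain ⟨C, hC⟩ := h2 α
      refine ⟨‖c‖ * C, fun x hx => ?_⟩
      rw [LinearMap.smul_apply, norm_smul, mul_assoc]
      exact mul_le_mul_of_nonneg_left (hC x hx) (norm_nonneg c)
    · simp only [LinearMap.smul_apply, map_smul, h3]

/-- The space `L(H, K)`. -/
def Op (H : LocallyHilbertSpace.{u, w} ι) (K : LocallyHilbertSpace.{u, w₁} ι) : Type (max w w₁) :=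
  opSubmodule H K

namespace Op

instance : AddCommGroup (Op H K) := inferInstanceAs (AddCommGroup (opSubmodule H K))

instance : Module ℂ (Op H K) := inferInstanceAs (Module ℂ (opSubmodule H K))

/-- The underlying linear map. -/
def toLin (T : Op H K) : H →ₗ[ℂ] K := T.1

instance : CoeFun (Op H K) (fun _ => H → K) := ⟨fun T => T.toLin⟩

theorem ext {T S : Op H K} (h : ∀ x, T x = S x) : T = S := Subtype.ext (LinearMap.ext h)

theorem map_mem (T : Op H K) {α : ι} {x : H} (hx : x ∈ H.level α) : T x ∈ K.level α :=
  T.2.1 α x hx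

theorem bound (T : Op H K) (α : ι) : ∃ C : ℝ, ∀ x ∈ H.level α, ‖T x‖ ≤ C * ‖x‖ := T.2.2.1 α

theorem proj_apply (T : Op H K) (α : ι) (x : H) :
    (K.level α).starProjection (T x) = T ((H.level α).starProjection x) := T.2.2.2 α x

/-- The component `T_α : H_α → K_α`. -/
def restrict (T : Op H K) (α : ι) : H.level α →L[ℂ] K.level α :=
  LinearMap.mkContinuousOfExistsBound (T.toLin.restrict fun _ hx => T.map_mem hx)
    (by
      obtain ⟨C, hC⟩ := T.bound α
      exact ⟨C, fun x => hC x x.2⟩)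

theorem coe_restrict (T : Op H K) (α : ι) (x : H.level α) : (T.restrict α x : K) = T x := rfl

/-- The topology of `L(H, K)`, generated by the seminorms `‖T‖_α = ‖T_α‖ = ‖T_α* T_α‖^(1/2)`: the
coarsest topology for which all the maps `T ↦ T_α` are continuous for the operator norms. -/
instance : TopologicalSpace (Op H K) :=
  ⨅ α, TopologicalSpace.induced (fun T : Op H K => T.restrict α) inferInstance

/-- Composition of operators. -/
def comp (T : Op K L) (S : Op H K) : Op H L :=
  ⟨T.toLin ∘ₗ S.toLin, fun _ _ hx => T.map_mem (S.map_mem hx), fun α => by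
    obtain ⟨C, hC⟩ := T.bound α
    obtain ⟨D, hD⟩ := S.bound α
    refine ⟨|C| * D, fun x hx => ?_⟩
    calc ‖T (S x)‖ ≤ C * ‖S x‖ := hC _ (S.map_mem hx)
      _ ≤ |C| * ‖S x‖ := mul_le_mul_of_nonneg_right (le_abs_self C) (norm_nonneg _)
      _ ≤ |C| * (D * ‖x‖) := mul_le_mul_of_nonneg_left (hD x hx) (abs_nonneg C)
      _ = |C| * D * ‖x‖ := (mul_assoc _ _ _).symm,
    fun α x => by
      change (L.level α).starProjection (T (S x)) = T (S ((H.level α).starProjection x))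
      rw [T.proj_apply, S.proj_apply]⟩

theorem exists_adjoint (T : Op H K) {α : ι} {y : K} (hy : y ∈ K.level α) :
    ∀ x : H, ⟪((T.restrict α).adjoint ⟨y, hy⟩ : H), x⟫_ℂ = ⟪y, T x⟫_ℂ := by
  intro x
  set z : H.level α := (T.restrict α).adjoint ⟨y, hy⟩ with hz
  have h1 : ⟪(z : H), x⟫_ℂ = ⟪(z : H), (H.level α).starProjection x⟫_ℂ := by
    rw [← Submodule.inner_starProjection_left_eq_right,
      Submodule.starProjection_eq_self_iff.mpr z.2]
  have h2 : ⟪y, T x⟫_ℂ = ⟪y, (K.level α).starProjection (T x)⟫_ℂ := by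
    rw [← Submodule.inner_starProjection_left_eq_right,
      Submodule.starProjection_eq_self_iff.mpr hy]
  rw [h1, h2, T.proj_apply]
  have h3 := (T.restrict α).adjoint_inner_left ((H.level α).orthogonalProjectionOnto x) ⟨y, hy⟩
  exact h3

/-- The function underlying the adjoint: `T* y = (T_α)* y` for `y ∈ K_α`. -/
def adjointFun (T : Op H K) (y : K) : H :=
  ((T.restrict (K.exists_mem_level y).choose).adjoint ⟨y, (K.exists_mem_level y).choose_spec⟩ :
    H.level _)

theorem adjointFun_inner (T : Op H K) (y : K) (x : H) : ⟪T.adjointFun y, x⟫_ℂ = ⟪y, T x⟫_ℂ :=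
  T.exists_adjoint _ x

theorem adjointFun_eq (T : Op H K) {α : ι} {y : K} (hy : y ∈ K.level α) :
    T.adjointFun y = ((T.restrict α).adjoint ⟨y, hy⟩ : H) :=
  ext_inner_right ℂ fun x => by rw [adjointFun_inner, exists_adjoint]

/-- The adjoint `T* ∈ L(K, H)` of `T ∈ L(H, K)`, with `T*|K_α = (T_α)*`. -/
def adjoint (T : Op H K) : Op K H :=
  ⟨{ toFun := T.adjointFun
     map_add' := fun y z => ext_inner_right ℂ fun x => by
       simp only [inner_add_left, adjointFun_inner]
     map_smul' := fun c y => ext_inner_right ℂ fun x => by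
       simp only [RingHom.id_apply, inner_smul_left, adjointFun_inner] },
    fun α y hy => by
      change T.adjointFun y ∈ _
      rw [T.adjointFun_eq hy]
      exact Subtype.property _,
    fun α => ⟨‖(T.restrict α).adjoint‖, fun y hy => by
      change ‖T.adjointFun y‖ ≤ _
      rw [T.adjointFun_eq hy]
      exact (T.restrict α).adjoint.le_opNorm ⟨y, hy⟩⟩,
    fun α y => ext_inner_right ℂ fun x => by
      change ⟪(H.level α).starProjection (T.adjointFun y), x⟫_ℂ =
        ⟪T.adjointFun ((K.level α).starProjection y), x⟫_ℂ
      rw [Submodule.inner_starProjection_left_eq_right, adjointFun_inner, adjointFun_inner,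
        Submodule.inner_starProjection_left_eq_right, T.proj_apply]⟩

theorem adjoint_inner_left (T : Op H K) (y : K) (x : H) : ⟪T.adjoint y, x⟫_ℂ = ⟪y, T x⟫_ℂ :=
  T.adjointFun_inner y x

theorem adjoint_restrict (T : Op H K) (α : ι) :
    T.adjoint.restrict α = (T.restrict α).adjoint :=
  ContinuousLinearMap.ext fun y => Subtype.ext (T.adjointFun_eq y.2)

/-- The identity operator. -/
def idOp (H : LocallyHilbertSpace.{u, w} ι) : Op H H :=
  ⟨LinearMap.id, fun _ _ hx => hx, fun _ => ⟨1, fun x _ => by simp⟩, fun _ _ => rfl⟩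

/-- `L(H) = L(H, H)` is a unital algebra under composition. -/
instance : Ring (Op H H) where
  __ := (inferInstance : AddCommGroup (Op H H))
  mul T S := T.comp S
  one := idOp H
  mul_assoc _ _ _ := rfl
  one_mul _ := rfl
  mul_one _ := rfl
  left_distrib T S R := ext fun x => map_add T.toLin (S x) (R x)
  right_distrib _ _ _ := rfl
  zero_mul _ := rfl
  mul_zero T := ext fun _ => map_zero T.toLin

instance : Algebra ℂ (Op H H) :=
  Algebra.ofModule (fun _ _ _ => rfl) (fun c T S => ext fun x => map_smul T.toLin c (S x))

/-- The adjoint is the involution of `L(H)`. -/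
instance : StarRing (Op H H) where
  star T := T.adjoint
  star_involutive T := ext fun x => ext_inner_right ℂ fun y => by
    change ⟪T.adjoint.adjoint x, y⟫_ℂ = _
    rw [adjoint_inner_left, ← inner_conj_symm, adjoint_inner_left, inner_conj_symm]
  star_mul T S := ext fun x => ext_inner_right ℂ fun y => by
    change ⟪(T.comp S).adjoint x, y⟫_ℂ = ⟪S.adjoint (T.adjoint x), y⟫_ℂ
    rw [adjoint_inner_left, adjoint_inner_left, adjoint_inner_left]
    rfl
  star_add T S := ext fun x => ext_inner_right ℂ fun y => by
    change ⟪(T + S).adjoint x, y⟫_ℂ = ⟪T.adjoint x + S.adjoint x, y⟫_ℂ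
    rw [inner_add_left, adjoint_inner_left, adjoint_inner_left, adjoint_inner_left,
      ← inner_add_right]
    rfl

end Op

end LocallyHilbertSpace

open LocallyHilbertSpace

/-! ### Complete positivity and representations -/

/-- A linear map between `*`-algebras is completely positive if all its amplifications to `k × k`
matrices map the elements `a* a` to positive elements. -/
def IsCompletelyPositive {B C : Type*} [Ring B] [StarRing B] [Algebra ℂ B] [Ring C] [StarRing C]
    [Algebra ℂ C] (φ : B →ₗ[ℂ] C) : Prop :=
  ∀ (k : ℕ) (a : Matrix (Fin k) (Fin k) B), IsPositiveElement ((star a * a).map φ)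

/-- The map `[φ] : M_n(B) → M_n(C)`, `(b_ij) ↦ (φ_ij(b_ij))`, of a matrix of linear maps. -/
def entrywiseMap {B C : Type*} [Ring B] [Algebra ℂ B] [Ring C] [Algebra ℂ C] {n : ℕ}
    (φ : Fin n → Fin n → B →ₗ[ℂ] C) :
    Matrix (Fin n) (Fin n) B →ₗ[ℂ] Matrix (Fin n) (Fin n) C where
  toFun b := Matrix.of fun i j => φ i j (b i j)
  map_add' b c := by ext i j; simp
  map_smul' z b := by ext i j; simp

section

variable {A : Type u} [Ring A] [StarRing A] [Algebra ℂ A] [StarModule ℂ A]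
  [UniformSpace A] [IsUniformAddGroup A] {M : Type v} [AddCommGroup M] [Module ℂ M]
  [Module Aᵐᵒᵖ M] [UniformSpace M] [IsUniformAddGroup M] [HilbertModule A M]
  {ι : Type u} [Preorder ι] [IsDirectedOrder ι]
  {H : LocallyHilbertSpace.{u, w} ι} {K : LocallyHilbertSpace.{u, w₁} ι}

/-- `[Φ]` is a `[φ]`-completely positive `n × n` matrix: `[φ]` is a continuous completely
`n`-positive map from `A` to `L(H)`, the `Φ_ij` are continuous, and `[Φ](x)* [Φ](y) = [φ](⟨x,y⟩)`
entry by entry. -/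
structure IsCompletelyPositiveMatrix {n : ℕ} (φ : Fin n → Fin n → A →ₗ[ℂ] Op H H)
    (Φ : Fin n → Fin n → M →ₗ[ℂ] Op H K) : Prop where
  continuous_left : Continuous (entrywiseMap φ)
  completelyPositive_left : IsCompletelyPositive (entrywiseMap φ)
  continuous_right : ∀ i j, Continuous (Φ i j)
  sum_adjoint_comp : ∀ (x y : M) (i j : Fin n),
    ∑ r, ((Φ r i x).adjoint).comp (Φ r j y) = φ i j (inner A x y)

/-- `Π : M → L(H, K)` is a representation of the Hilbert module `M`, associated with the continuous
`*`-representation `π` of `A` on `H`. -/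
structure IsRepresentation (P : M →ₗ[ℂ] Op H K) (π : A →⋆ₐ[ℂ] Op H H) : Prop where
  continuous_module : Continuous P
  continuous_algebra : Continuous π
  adjoint_comp : ∀ x y : M, ((P x).adjoint).comp (P y) = π (inner A x y)

end

end

noncomputable section

open scoped InnerProductSpace Topology

open LocallyHilbertSpace

/-! The form `⟨x ⊗ ξ e_i, y ⊗ η e_j⟩ = ⟨ξ, φ_ij(⟨x, y⟩) η⟩` is positive semidefinite in two cases:
for `M = A` by complete positivity, and for the given module because it is the Gram kernel of the
column vectors `(Φ_ri(x) ξ)_r`. The resulting interior tensor products are `H^Φ` and `K^Φ`, with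
levels spanned by the elementary tensors with `ξ ∈ H_α`. On them `π(a) (b ⊗ ξ e_i) = a b ⊗ ξ e_i`
and `Π(x) (b ⊗ ξ e_i) = x b ⊗ ξ e_i`, `S_i ξ = 1 ⊗ ξ e_i`, and `W_r*` reads off the `r`-th
coordinate of a column vector. For the bounds on the level `α`, let `p` be a continuous C*-seminorm
that dominates the `φ_ii` there up to a constant: iterating the Cauchy-Schwarz inequality along the
powers `(a* a) ^ 2 ^ m` removes the constant and gives `‖π(a)‖_α ≤ p(a)`, hence
`‖Π(x)‖_α² ≤ p(⟨x, x⟩)`. -/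

/-! ### Continuous C*-seminorms -/

theorem le_of_pow_two_pow_le {a q C : ℝ} (hq : 0 ≤ q)
    (h : ∀ m : ℕ, a ^ 2 ^ m ≤ C * q ^ 2 ^ m) : a ≤ q := by
  by_contra! hqa
  rcases hq.eq_or_lt with rfl | hq
  · have h0 := h 0
    simp only [pow_zero, pow_one, mul_zero] at h0
    exact hqa.not_ge h0
  have hr : 1 < a / q := (one_lt_div hq).mpr hqa
  obtain ⟨m, hm⟩ := pow_unbounded_of_one_lt C hr
  have hle : (a / q) ^ 2 ^ m ≤ C := by
    rw [div_pow, div_le_iff₀ (by positivity)]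
    exact h m
  exact (hm.trans_le (pow_le_pow_right₀ hr.le Nat.lt_two_pow_self.le)).not_ge hle

theorem le_mul_of_sq_le_mul_succ {x : ℕ → ℝ} {N q D : ℝ} (hN : 0 ≤ N) (hq : 0 ≤ q)
    (hx : ∀ m, 0 ≤ x m) (hsq : ∀ m, x m ^ 2 ≤ N * x (m + 1))
    (hD : ∀ m, x m ≤ D * q ^ 2 ^ m) : x 0 ≤ q * N := by
  rcases hN.eq_or_lt with rfl | hN
  · have h0 := hsq 0
    rw [zero_mul] at h0
    rw [mul_zero, pow_eq_zero_iff two_ne_zero |>.mp (h0.antisymm (sq_nonneg _))]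
  have hpow : ∀ m, (x 0 / N) ^ 2 ^ m ≤ x m / N := by
    intro m
    induction m with
    | zero => simp only [pow_zero, pow_one, le_refl]
    | succ m ih =>
      calc (x 0 / N) ^ 2 ^ (m + 1) = ((x 0 / N) ^ 2 ^ m) ^ 2 := by rw [pow_succ, pow_mul]
        _ ≤ (x m / N) ^ 2 := pow_le_pow_left₀ (pow_nonneg (div_nonneg (hx 0) hN.le) _) ih 2
        _ = x m ^ 2 / N / N := by rw [div_pow, sq N, div_div]
        _ ≤ N * x (m + 1) / N / N := by gcongr; exact hsq m
        _ = x (m + 1) / N := by rw [mul_div_cancel_left₀ _ hN.ne']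
  refine (div_le_iff₀ hN).mp (le_of_pow_two_pow_le (C := D / N) hq fun m => (hpow m).trans ?_)
  rw [div_mul_eq_mul_div]
  gcongr
  exact hD m

namespace CStarSeminorm

variable {A : Type u} [Ring A] [StarRing A] [Algebra ℂ A] [TopologicalSpace A]

theorem map_pow_two_pow_le (p : CStarSeminorm A) (a : A) (m : ℕ) :
    p (a ^ 2 ^ m) ≤ p a ^ 2 ^ m := by
  induction m with
  | zero => simp only [pow_zero, pow_one, le_refl]
  | succ m ih =>
    rw [pow_succ, pow_mul, pow_mul, sq, sq]
    exact (p.mul_le _ _).trans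
      (mul_le_mul ih ih (apply_nonneg _ _) (pow_nonneg (apply_nonneg _ _) _))

/-- The C*-identity improves any bound `D` to the bound `‖f 1‖`: the estimate
`‖f c‖² ≤ ‖f 1‖ ‖f (c* c)‖` can be iterated along the powers `(a* a) ^ 2 ^ m`. -/
theorem norm_le_of_inner_eq {E : Type*} [NormedAddCommGroup E] [InnerProductSpace ℂ E]
    (p : CStarSeminorm A) {f : A → E} (hf : ∀ a b, ⟪f a, f b⟫_ℂ = ⟪f 1, f (star a * b)⟫_ℂ)
    {D : ℝ} (hD : ∀ a, ‖f a‖ ≤ D * p a) (a : A) : ‖f a‖ ≤ p a * ‖f 1‖ := by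
  have hsq : ∀ c, ‖f c‖ ^ 2 ≤ ‖f 1‖ * ‖f (star c * c)‖ := fun c => by
    rw [← inner_self_eq_norm_sq (𝕜 := ℂ), hf]
    exact (Complex.re_le_norm _).trans (norm_inner_le_norm _ _)
  have hD' : ∀ c, ‖f c‖ ≤ |D| * p c := fun c =>
    (hD c).trans (mul_le_mul_of_nonneg_right (le_abs_self D) (apply_nonneg _ _))
  have hstar : ∀ m : ℕ, star ((star a * a) ^ 2 ^ m) * (star a * a) ^ 2 ^ m =
      (star a * a) ^ 2 ^ (m + 1) := fun m => by
    rw [star_pow, star_mul, star_star, pow_succ, pow_mul _ (2 ^ m), sq]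
  have hself : ‖f (star a * a)‖ ≤ p (star a * a) * ‖f 1‖ := by
    simpa only [pow_zero, pow_one] using
      le_mul_of_sq_le_mul_succ (x := fun m => ‖f ((star a * a) ^ 2 ^ m)‖) (norm_nonneg _)
        (apply_nonneg _ _) (fun m => norm_nonneg _)
        (fun m => (hsq _).trans_eq (by rw [hstar]))
        (fun m => (hD' _).trans
          (mul_le_mul_of_nonneg_left (p.map_pow_two_pow_le _ m) (abs_nonneg D)))
  refine le_of_sq_le_sq ?_ (mul_nonneg (apply_nonneg _ _) (norm_nonneg _))
  calc ‖f a‖ ^ 2 ≤ ‖f 1‖ * ‖f (star a * a)‖ := hsq a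
    _ ≤ ‖f 1‖ * (p (star a * a) * ‖f 1‖) := by gcongr
    _ = (p a * ‖f 1‖) ^ 2 := by rw [p.star_mul_self]; ring

theorem exists_norm_le_of_continuous {F : Type*} [NormedAddCommGroup F] [NormedSpace ℂ F]
    (hA : (𝓝 (0 : A)).HasBasis (fun b : CStarSeminorm A × ℝ => 0 < b.2)
      (fun b => {a : A | b.1 a < b.2}))
    {f : A →ₗ[ℂ] F} (hf : Continuous f) :
    ∃ (p : CStarSeminorm A) (C : ℝ), ∀ a, ‖f a‖ ≤ C * p a := by
  have hball : f ⁻¹' Metric.ball 0 1 ∈ 𝓝 (0 : A) :=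
    hf.continuousAt.preimage_mem_nhds (by
      rw [map_zero]
      exact Metric.ball_mem_nhds 0 one_pos)
  obtain ⟨⟨p, ε⟩, hε : 0 < ε, hp⟩ := hA.mem_iff.mp hball
  refine ⟨p, ε⁻¹, fun a => ?_⟩
  rw [inv_mul_eq_div, le_div_iff₀ hε]
  refine le_of_forall_gt_imp_ge_of_dense fun r hr => ?_
  have hr0 : 0 < r := (apply_nonneg p.toSeminorm a).trans_lt hr
  have hc : ‖((ε / r : ℝ) : ℂ)‖ = ε / r := Complex.norm_of_nonneg (by positivity)
  have hmem : ((ε / r : ℝ) : ℂ) • a ∈ {a : A | p a < ε} := by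
    change p _ < ε
    rw [map_smul_eq_mul, hc, div_mul_eq_mul_div, div_lt_iff₀ hr0]
    exact mul_lt_mul_of_pos_left hr hε
  have hlt : ‖f (((ε / r : ℝ) : ℂ) • a)‖ < 1 := mem_ball_zero_iff.mp (hp hmem)
  rw [map_smul, norm_smul, hc, div_mul_eq_mul_div, div_lt_one hr0] at hlt
  rw [mul_comm]
  exact hlt.le

end CStarSeminorm

/-! ### Operators between locally Hilbert spaces -/

namespace LocallyHilbertSpace

variable {ι : Type*} [Preorder ι] [IsDirectedOrder ι]
  {H : LocallyHilbertSpace.{_, w} ι} {K : LocallyHilbertSpace.{_, w₁} ι}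

theorem isClosed_level (H : LocallyHilbertSpace.{_, w} ι) (α : ι) :
    IsClosed (H.level α : Set H) :=
  (completeSpace_coe_iff_isComplete.mp (H.level_complete α)).isClosed

namespace Op

theorem sum_apply {J : Type*} (s : Finset J) (T : J → Op H K) (x : H) :
    (∑ j ∈ s, T j : Op H K) x = ∑ j ∈ s, T j x := by
  have hsum : (∑ j ∈ s, T j : Op H K).toLin = ∑ j ∈ s, (T j).toLin :=
    map_sum (opSubmodule H K).subtype T s
  rw [hsum, LinearMap.sum_apply]

theorem inner_adjoint_right (T : Op H K) (x : H) (y : K) :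
    ⟪x, T.adjoint y⟫_ℂ = ⟪T x, y⟫_ℂ := by
  rw [← inner_conj_symm, adjoint_inner_left, inner_conj_symm]

theorem adjoint_adjoint (T : Op H K) : T.adjoint.adjoint = T :=
  ext fun x => ext_inner_right ℂ fun y => by rw [adjoint_inner_left, inner_adjoint_right]

/-- The component map `T ↦ T_α` as a linear map. -/
def restrictₗ (H : LocallyHilbertSpace.{_, w} ι) (K : LocallyHilbertSpace.{_, w₁} ι) (α : ι) :
    Op H K →ₗ[ℂ] H.level α →L[ℂ] K.level α where
  toFun T := T.restrict α
  map_add' _ _ := rfl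
  map_smul' _ _ := rfl

theorem continuous_restrictₗ (α : ι) : Continuous (restrictₗ H K α) :=
  continuous_iInf_dom continuous_induced_dom

theorem norm_apply_le_restrict (T : Op H K) {α : ι} {x : H} (hx : x ∈ H.level α) :
    ‖T x‖ ≤ ‖T.restrict α‖ * ‖x‖ :=
  (T.restrict α).le_opNorm ⟨x, hx⟩

theorem continuous_of_norm_apply_le {E : Type*} [AddCommGroup E] [Module ℂ E]
    [TopologicalSpace E] [IsTopologicalAddGroup E] (f : E →ₗ[ℂ] Op H K) {q : ι → E → ℝ}
    (hq : ∀ α, Filter.Tendsto (q α) (𝓝 0) (𝓝 0))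
    (hf : ∀ α e, ∀ x ∈ H.level α, ‖f e x‖ ≤ q α e * ‖x‖) : Continuous f := by
  refine continuous_iInf_rng.mpr fun α => continuous_induced_rng.mpr ?_
  refine continuous_of_continuousAt_zero (restrictₗ H K α ∘ₗ f) ?_
  rw [ContinuousAt, map_zero]
  refine squeeze_zero_norm (E := H.level α →L[ℂ] K.level α) (fun e => ?_)
    (abs_zero (α := ℝ) ▸ (hq α).abs)
  exact ContinuousLinearMap.opNorm_le_bound _ (abs_nonneg _) fun x =>
    (hf α e x x.2).trans (mul_le_mul_of_nonneg_right (le_abs_self _) (norm_nonneg _))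

theorem continuous_topology (T : Op H K) : @Continuous H K H.topology K.topology T := by
  have hT : ∀ α, @Continuous _ _ (H.levelTopology α) (K.levelTopology α) (T.restrict α) :=
    fun α => (T.restrict α).continuous
  refine continuous_sInf_rng.mpr fun τ ⟨hadd, hsmul, hconv, hincl⟩ => ?_
  rw [continuous_iff_le_induced]
  refine sInf_le ⟨topologicalAddGroup_induced T.toLin, continuousSMul_induced T.toLin,
    LocallyConvexSpace.induced (T.toLin.restrictScalars ℝ), fun α => ?_⟩
  rw [continuous_induced_rng]
  exact @Continuous.comp _ _ _ (H.levelTopology α) (K.levelTopology α) τ _ _ (hincl α) (hT α)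

end Op

end LocallyHilbertSpace

/-! ### Generating families -/

theorem isComplete_of_isClosed_of_subset {X : Type*} [UniformSpace X] {s t : Set X}
    (hs : IsComplete s) (ht : IsClosed t) (hts : t ⊆ s) : IsComplete t := fun f hf hft => by
  obtain ⟨x, -, hx⟩ := hs f hf (hft.trans (Filter.principal_mono.mpr hts))
  have := hf.1
  exact ⟨x, ht.mem_of_tendsto (f := id) hx (Filter.le_principal_iff.mp hft), hx⟩

namespace LocallyHilbertSpace

variable {ι : Type*} [Preorder ι] [IsDirectedOrder ι]
  {H : LocallyHilbertSpace.{_, w} ι} {K : LocallyHilbertSpace.{_, w₁} ι}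

/-- The locally Hilbert space with levels `L α` inside a given inner product space; its carrier is
the union of the `L α`. -/
def ofSubmodules [Nonempty ι] {E : Type w} [NormedAddCommGroup E] [InnerProductSpace ℂ E]
    (L : ι → Submodule ℂ E) (hL : Monotone L) (hc : ∀ α, IsComplete (L α : Set E)) :
    LocallyHilbertSpace.{_, w} ι where
  carrier := (⨆ α, L α : Submodule ℂ E)
  level α := (L α).comap (⨆ α, L α).subtype
  level_mono _ _ h := Submodule.comap_mono (hL h)
  level_complete α := by
    refine completeSpace_coe_iff_isComplete.mpr ?_
    rw [← isComplete_image_iff (⨆ α, L α).subtypeₗᵢ.isometry.isUniformInducing]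
    refine (congrArg IsComplete (Set.ext fun x => ?_)).mp (hc α)
    exact ⟨fun hx => ⟨⟨x, le_iSup L α hx⟩, hx, rfl⟩, fun ⟨_, hy, h⟩ => h ▸ hy⟩
  exists_mem_level x := (Submodule.mem_iSup_of_directed L hL.directed_le).mp x.2

variable {G G' : Type*} {s : ι → Set G} {k : G → H} {s' : ι → Set G'} {k' : G' → K}

/-- The levels of `H` are the closed linear spans of the vectors `k g`, `g ∈ s α`. -/
structure Generates (H : LocallyHilbertSpace.{_, w} ι) (s : ι → Set G) (k : G → H) : Prop where
  level_eq : ∀ α, (H.level α : Set H) = closure (Submodule.span ℂ (k '' s α) : Set H)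

theorem exists_generates [Nonempty ι] {E : Type w} [NormedAddCommGroup E] [InnerProductSpace ℂ E]
    (k : G → E) (hs : Monotone s) (hmem : ∀ g, ∃ α, g ∈ s α) {L : ι → Submodule ℂ E}
    (hL : ∀ α, IsComplete (L α : Set E)) (hkL : ∀ α, ∀ g ∈ s α, k g ∈ L α) :
    ∃ (H : LocallyHilbertSpace.{_, w} ι) (j : H →ₗᵢ[ℂ] E) (k' : G → H),
      (∀ g, j (k' g) = k g) ∧ Generates H s k' := by
  let N : ι → Submodule ℂ E := fun α => (Submodule.span ℂ (k '' s α)).topologicalClosure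
  have hN : Monotone N := fun α β h =>
    Submodule.topologicalClosure_mono (Submodule.span_mono (Set.image_mono (hs h)))
  have hNc : ∀ α, IsComplete (N α : Set E) := fun α =>
    isComplete_of_isClosed_of_subset (hL α) (Submodule.isClosed_topologicalClosure _)
      (Submodule.topologicalClosure_minimal _
        (Submodule.span_le.mpr (Set.image_subset_iff.mpr (hkL α))) (hL α).isClosed)
  have hkN : ∀ g, k g ∈ ⨆ α, N α := fun g => by
    obtain ⟨α, hα⟩ := hmem g
    exact le_iSup N α (subset_closure (Submodule.subset_span ⟨g, hα, rfl⟩))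
  let k' : G → (⨆ α, N α : Submodule ℂ E) := fun g => ⟨k g, hkN g⟩
  refine ⟨ofSubmodules N hN hNc, (⨆ α, N α).subtypeₗᵢ, k', fun g => rfl,
    ⟨fun α => Set.ext fun (x : (⨆ α, N α : Submodule ℂ E)) => ?_⟩⟩
  have himg : (⨆ α, N α).subtype '' (Submodule.span ℂ (k' '' s α)) =
      (Submodule.span ℂ (k '' s α) : Set E) := by
    rw [← Submodule.map_coe, Submodule.map_span, ← Set.image_comp]
    rfl
  change (x : E) ∈ closure (Submodule.span ℂ (k '' s α) : Set E) ↔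
    x ∈ closure (Submodule.span ℂ (k' '' s α) : Set (⨆ α, N α : Submodule ℂ E))
  rw [closure_subtype, ← himg]
  rfl

namespace Generates

theorem mem_level (hk : Generates H s k) {α : ι} {g : G} (hg : g ∈ s α) : k g ∈ H.level α := by
  rw [← SetLike.mem_coe, hk.level_eq]
  exact subset_closure (Submodule.subset_span ⟨g, hg, rfl⟩)

theorem level_le (hk : Generates H s k) {α : ι} {S : Submodule ℂ H} (hS : IsClosed (S : Set H))
    (h : ∀ g ∈ s α, k g ∈ S) : H.level α ≤ S := by
  rw [← SetLike.coe_subset_coe, hk.level_eq]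
  exact closure_minimal (Submodule.span_le.mpr (Set.image_subset_iff.mpr h)) hS

theorem inner_eq_zero (hk : Generates H s k) {α : ι} {x y : H}
    (h : ∀ g ∈ s α, ⟪k g, x⟫_ℂ = 0) (hy : y ∈ H.level α) : ⟪y, x⟫_ℂ = 0 :=
  Submodule.mem_orthogonal_singleton_iff_inner_left.mp <|
    hk.level_le (S := (ℂ ∙ x)ᗮ) (Submodule.isClosed_orthogonal _)
      (fun g hg => Submodule.mem_orthogonal_singleton_iff_inner_left.mpr (h g hg)) hy

theorem eq_of_inner (hk : Generates H s k) {x y : H} (h : ∀ g, ⟪k g, x⟫_ℂ = ⟪k g, y⟫_ℂ) :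
    x = y := by
  obtain ⟨α, hα⟩ := H.exists_mem_level (x - y)
  refine sub_eq_zero.mp (inner_self_eq_zero (𝕜 := ℂ).mp (hk.inner_eq_zero (fun g _ => ?_) hα))
  rw [inner_sub_right, h, sub_self]

theorem clm_ext (hk : Generates H s k) {F : Type*} [NormedAddCommGroup F] [NormedSpace ℂ F]
    {f f' : H →L[ℂ] F} (h : ∀ g, f (k g) = f' (k g)) : f = f' := by
  ext x
  obtain ⟨α, hα⟩ := H.exists_mem_level x
  exact hk.level_le (S := LinearMap.eqLocus f.toLinearMap f'.toLinearMap)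
    (isClosed_eq f.continuous f'.continuous) (fun g _ => h g) hα

theorem op_ext (hk : Generates H s k) {T S : Op H K} (h : ∀ g, T (k g) = S (k g)) : T = S := by
  have hadj : ∀ y, T.adjoint y = S.adjoint y := fun y => hk.eq_of_inner fun g => by
    rw [← inner_conj_symm, Op.adjoint_inner_left, h, ← Op.adjoint_inner_left, inner_conj_symm]
  refine Op.ext fun x => ext_inner_left ℂ fun y => ?_
  rw [← Op.adjoint_inner_left, hadj, Op.adjoint_inner_left]

theorem closedSpan_eq_univ (hk : Generates H s k) {Y : Set H} (hY : ∀ g, k g ∈ Y) :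
    H.closedSpan Y = Set.univ := by
  refine Set.eq_univ_of_forall fun x => ?_
  obtain ⟨α, hα⟩ := H.exists_mem_level x
  have hincl : @Continuous (H.level α) H (H.levelTopology α) H.topology Subtype.val :=
    continuous_sInf_rng.mpr fun τ hτ => hτ.2.2.2 α
  have hspan : Submodule.span ℂ (k '' s α) ≤ H.level α :=
    Submodule.span_le.mpr (Set.image_subset_iff.mpr fun g hg => hk.mem_level hg)
  have hx : (⟨x, hα⟩ : H.level α) ∈ closure {z : H.level α | (z : H) ∈ Submodule.span ℂ Y} := by
    have hx' : x ∈ closure (Submodule.span ℂ (k '' s α) : Set H) := hk.level_eq α ▸ hα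
    rw [closure_subtype]
    refine closure_mono ?_ hx'
    exact fun z hz => ⟨⟨z, hspan hz⟩,
      Submodule.span_mono (Set.image_subset_iff.mpr fun g _ => hY g) hz, rfl⟩
  exact @map_mem_closure _ _ (H.levelTopology α) H.topology _ _ _ _ hincl hx fun z hz => hz

end Generates

/-- A linear map into a generated locally Hilbert space is an element of `L(H, K)` as soon as it
respects the levels, is bounded on them, and its adjoint maps the generators of each level into that
level: the last condition makes it commute with the projections. -/
def Op.ofDual (hk' : Generates K s' k') (T : H →ₗ[ℂ] K) (t' : G' → H)
    (hT : ∀ α, ∀ x ∈ H.level α, T x ∈ K.level α)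
    (hC : ∀ α, ∃ C : ℝ, ∀ x ∈ H.level α, ‖T x‖ ≤ C * ‖x‖)
    (ht' : ∀ α, ∀ g ∈ s' α, t' g ∈ H.level α)
    (hTt : ∀ g x, ⟪k' g, T x⟫_ℂ = ⟪t' g, x⟫_ℂ) : Op H K :=
  ⟨T, hT, hC, fun α x => by
    refine Submodule.eq_starProjection_of_mem_of_inner_eq_zero
      (hT α _ (Submodule.starProjection_apply_mem _ x)) fun y hy => ?_
    rw [← map_sub, ← inner_conj_symm, hk'.inner_eq_zero (fun g hg => ?_) hy, map_zero]
    rw [hTt]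
    exact Submodule.inner_right_of_mem_orthogonal (ht' α g hg)
      (Submodule.sub_starProjection_mem_orthogonal x)⟩

namespace Generates

theorem denseRange_linearCombination (hk : Generates H s k) (α : ι) :
    DenseRange (Finsupp.linearCombination ℂ
      fun g : s α => (⟨k g, hk.mem_level g.2⟩ : H.level α)) := fun x => by
  have himg : Subtype.val '' Set.range (Finsupp.linearCombination ℂ
      fun g : s α => (⟨k g, hk.mem_level g.2⟩ : H.level α)) =
      (Submodule.span ℂ (k '' s α) : Set H) := by
    rw [← LinearMap.coe_range, Finsupp.range_linearCombination, ← Submodule.coe_subtype,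
      ← Submodule.map_coe, Submodule.map_span, ← Set.range_comp, Set.image_eq_range]
    rfl
  rw [closure_subtype, himg, ← hk.level_eq]
  exact x.2

theorem exists_level_extension (hk : Generates H s k) {t : G → K} {t' : G' → H} {α : ι}
    (ht : ∀ g ∈ s α, t g ∈ K.level α) (htt : ∀ g g', ⟪k' g', t g⟫_ℂ = ⟪t' g', k g⟫_ℂ) {C : ℝ}
    (hC : ∀ v : s α →₀ ℂ, ‖Finsupp.linearCombination ℂ (fun g : s α => t g) v‖ ≤
      C * ‖Finsupp.linearCombination ℂ (fun g : s α => k g) v‖) :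
    ∃ f : H.level α → K.level α,
      (∀ x g', ⟪k' g', (f x : K)⟫_ℂ = ⟪t' g', (x : H)⟫_ℂ) ∧ ∀ x, ‖f x‖ ≤ C * ‖x‖ := by
  let e := Finsupp.linearCombination ℂ fun g : s α => (⟨k g, hk.mem_level g.2⟩ : H.level α)
  let f := Finsupp.linearCombination ℂ fun g : s α => (⟨t g, ht g g.2⟩ : K.level α)
  have he : ∀ v, (e v : H) = Finsupp.linearCombination ℂ (fun g : s α => k g) v :=
    Finsupp.apply_linearCombination ℂ (H.level α).subtype _
  have hf : ∀ v, (f v : K) = Finsupp.linearCombination ℂ (fun g : s α => t g) v :=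
    Finsupp.apply_linearCombination ℂ (K.level α).subtype _
  have hdense : DenseRange e := hk.denseRange_linearCombination α
  have hfe : ∀ v, ‖f v‖ ≤ C * ‖e v‖ := fun v => by
    rw [Submodule.coe_norm, Submodule.coe_norm, he, hf]
    exact hC v
  refine ⟨f.extendOfNorm e, fun x g' => ?_, LinearMap.norm_extendOfNorm_apply_le hdense C hfe⟩
  refine hdense.induction_on x (isClosed_eq (by fun_prop) (by fun_prop)) fun v => ?_
  rw [LinearMap.extendOfNorm_eq hdense ⟨C, hfe⟩, he, hf]
  simp only [Finsupp.linearCombination_apply, Finsupp.inner_sum, inner_smul_right, htt]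

theorem exists_op (hk : Generates H s k) (hk' : Generates K s' k') {t : G → K} {t' : G' → H}
    (ht : ∀ α, ∀ g ∈ s α, t g ∈ K.level α) (ht' : ∀ α, ∀ g ∈ s' α, t' g ∈ H.level α)
    (htt : ∀ g g', ⟪k' g', t g⟫_ℂ = ⟪t' g', k g⟫_ℂ) {C : ι → ℝ}
    (hC : ∀ α (v : s α →₀ ℂ), ‖Finsupp.linearCombination ℂ (fun g : s α => t g) v‖ ≤
      C α * ‖Finsupp.linearCombination ℂ (fun g : s α => k g) v‖) :
    ∃ T : Op H K, (∀ g, T (k g) = t g) ∧ (∀ g', T.adjoint (k' g') = t' g') ∧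
      ∀ α, ∀ x ∈ H.level α, ‖T x‖ ≤ C α * ‖x‖ := by
  choose f hf hfC using fun α => hk.exists_level_extension (ht α) htt (hC α)
  choose lev hlev using H.exists_mem_level
  let T₀ : H → K := fun x => f (lev x) ⟨x, hlev x⟩
  have hT₀ : ∀ x g', ⟪k' g', T₀ x⟫_ℂ = ⟪t' g', x⟫_ℂ := fun x => hf (lev x) ⟨x, hlev x⟩
  have hT₀f : ∀ α (x : H.level α), T₀ x = f α x := fun α x =>
    hk'.eq_of_inner fun g' => by rw [hT₀, hf]
  let T : H →ₗ[ℂ] K :=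
    { toFun := T₀
      map_add' := fun x y => hk'.eq_of_inner fun g' => by simp only [inner_add_right, hT₀]
      map_smul' := fun c x => hk'.eq_of_inner fun g' => by
        simp only [inner_smul_right, hT₀, RingHom.id_apply] }
  have hbound : ∀ α, ∀ x ∈ H.level α, ‖T x‖ ≤ C α * ‖x‖ := fun α x hx =>
    (congrArg norm (hT₀f α ⟨x, hx⟩)).trans_le (hfC α ⟨x, hx⟩)
  refine ⟨Op.ofDual hk' T t' (fun α x hx => ?_) (fun α => ⟨C α, hbound α⟩) ht' fun g x => hT₀ x g,
    fun g => hk'.eq_of_inner fun g' => (hT₀ _ _).trans (htt _ _).symm,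
    fun g' => ext_inner_right ℂ fun x => (Op.adjoint_inner_left _ _ _).trans (hT₀ _ _), hbound⟩
  change T₀ x ∈ K.level α
  rw [hT₀f α ⟨x, hx⟩]
  exact (f α _).2

end Generates

end LocallyHilbertSpace

/-! ### Positive semidefinite kernels -/

theorem inner_linearCombination_congr {G G' E F : Type*} [NormedAddCommGroup E]
    [InnerProductSpace ℂ E] [NormedAddCommGroup F] [InnerProductSpace ℂ F]
    {a : G → E} {b : G' → E} {a' : G → F} {b' : G' → F}
    (h : ∀ g g', ⟪a g, b g'⟫_ℂ = ⟪a' g, b' g'⟫_ℂ) (v : G →₀ ℂ) (v' : G' →₀ ℂ) :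
    ⟪Finsupp.linearCombination ℂ a v, Finsupp.linearCombination ℂ b v'⟫_ℂ =
      ⟪Finsupp.linearCombination ℂ a' v, Finsupp.linearCombination ℂ b' v'⟫_ℂ := by
  simp only [Finsupp.linearCombination_apply, Finsupp.sum, sum_inner, inner_sum, inner_smul_left,
    inner_smul_right, h]

section

open scoped ComplexOrder

theorem posSemidef_of_submatrix {G : Type*} {κ : Matrix G G ℂ}
    (h : ∀ s : Finset G, (κ.submatrix ((↑) : s → G) (↑)).PosSemidef) : κ.PosSemidef := by
  classical
  refine ⟨Matrix.IsHermitian.ext fun g g' => ?_, fun v => ?_⟩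
  · exact (h {g, g'}).1.apply ⟨g, by simp⟩ ⟨g', by simp⟩
  · have hv := (h v.support).2 (v.subtypeDomain (· ∈ v.support))
    refine hv.trans_eq ?_
    rw [← Finsupp.sum_subtypeDomain_index (p := (· ∈ v.support)) fun _ hx => hx]
    refine Finsupp.sum_congr fun g _ => ?_
    rw [← Finsupp.sum_subtypeDomain_index (p := (· ∈ v.support)) fun _ hx => hx]
    rfl

theorem exists_inner_eq_of_posSemidef {G : Type w} {κ : Matrix G G ℂ} (hκ : κ.PosSemidef) :
    ∃ (E : Type w) (_ : NormedAddCommGroup E) (_ : InnerProductSpace ℂ E) (_ : CompleteSpace E)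
      (k : G → E), ∀ g h, ⟪k g, k h⟫_ℂ = κ g h := by
  let κ' : Matrix G G (ℂ →L[ℂ] ℂ) := Matrix.of fun g h => κ g h • (1 : ℂ →L[ℂ] ℂ)
  have hκ' : κ'.PosSemidef := by
    have htfae := (RKHS.posSemidef_tfae (K := κ')).out 0 2
    refine htfae.mpr ⟨Matrix.IsHermitian.ext fun g h => ?_, fun v => ?_⟩
    · simp [κ', ← hκ.1.apply g h]
    · refine (Complex.nonneg_iff.mp (hκ.2 v)).1.trans_eq (congrArg Complex.re ?_)
      refine Finsupp.sum_congr fun g _ => Finsupp.sum_congr fun h _ => ?_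
      simp [κ', ← hκ.1.apply g h, mul_comm]
  have : Fact κ'.PosSemidef := ⟨hκ'⟩
  refine ⟨RKHS.OfKernel κ', inferInstance, inferInstance, inferInstance,
    fun g => RKHS.kerFun (RKHS.OfKernel κ') g 1, fun g h => ?_⟩
  rw [← RKHS.kernel_inner, RKHS.OfKernel.kernel_ofKernel]
  simp [κ', ← hκ.1.apply g h]

end

namespace IsCompletelyPositive

variable {A C : Type*} [Ring A] [StarRing A] [Algebra ℂ A] [Ring C] [StarRing C] [Algebra ℂ C]
  {n : ℕ} {φ : Fin n → Fin n → A →ₗ[ℂ] C}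

/-- Apply complete positivity to the matrix of matrices whose first row is
`(a_k ⊗ e_{i_0 i_k})_k` and whose other rows vanish. -/
theorem exists_gram_fin (hφ : IsCompletelyPositive (entrywiseMap φ)) {m : ℕ}
    (i : Fin m → Fin n) (a : Fin m → A) :
    ∃ d : Fin m × Fin n → Fin m → C, ∀ k l,
      φ (i k) (i l) (star (a k) * a l) = ∑ ν, star (d ν k) * d ν l := by
  rcases m.eq_zero_or_pos with rfl | hm
  · exact ⟨0, fun k => k.elim0⟩
  let o : Fin m := ⟨0, hm⟩
  let b : Matrix (Fin m) (Fin m) (Matrix (Fin n) (Fin n) A) :=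
    Matrix.of fun s k => if s = o then Matrix.single (i o) (i k) (a k) else 0
  obtain ⟨c, hc⟩ := hφ m b
  refine ⟨fun ν k => c ν.1 k ν.2 (i k), fun k l => ?_⟩
  have hb : (star b * b) k l = Matrix.single (i k) (i l) (star (a k) * a l) := by
    rw [Matrix.mul_apply, Finset.sum_eq_single o]
    · simp [b, Matrix.star_apply, Matrix.star_eq_conjTranspose]
    · intro s _ hs
      simp [b, hs]
    · simp
  have hbc : entrywiseMap φ ((star b * b) k l) (i k) (i l) = (star c * c) k l (i k) (i l) :=
    congrFun (congrFun (congrFun (congrFun hc k) l) (i k)) (i l)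
  calc φ (i k) (i l) (star (a k) * a l) = entrywiseMap φ ((star b * b) k l) (i k) (i l) := by
        rw [hb]
        simp only [entrywiseMap, LinearMap.coe_mk, AddHom.coe_mk, Matrix.of_apply,
          Matrix.single_apply_same]
    _ = ∑ ν : Fin m × Fin n, star (c ν.1 k ν.2 (i k)) * c ν.1 l ν.2 (i l) := by
        rw [hbc, Matrix.mul_apply, Matrix.sum_apply, Fintype.sum_prod_type]
        exact Finset.sum_congr rfl fun s _ => Matrix.mul_apply

theorem exists_gram (hφ : IsCompletelyPositive (entrywiseMap φ)) {J : Type*} [Finite J]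
    (i : J → Fin n) (a : J → A) :
    ∃ (N : ℕ) (d : Fin N × Fin n → J → C), ∀ k l,
      φ (i k) (i l) (star (a k) * a l) = ∑ ν, star (d ν k) * d ν l := by
  obtain ⟨m, ⟨e⟩⟩ := Finite.exists_equiv_fin J
  obtain ⟨d, hd⟩ := hφ.exists_gram_fin (i ∘ e.symm) (a ∘ e.symm)
  refine ⟨_, fun ν k => d ν (e k), fun k l => ?_⟩
  simpa only [Function.comp_apply, Equiv.symm_apply_apply] using hd (e k) (e l)

end IsCompletelyPositive

/-! ### The interior tensor product -/

/-- An `A`-valued hermitian form on a right `A`-module, linear in the second variable: an inner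
product without positivity and definiteness. -/
structure IsHermitianForm {A M : Type*} [Ring A] [StarRing A] [Algebra ℂ A] [AddCommGroup M]
    [Module ℂ M] [Module Aᵐᵒᵖ M] (B : M → M → A) : Prop where
  add_right : ∀ x y z, B x (y + z) = B x y + B x z
  smul_right : ∀ (x y) (c : ℂ), B x (c • y) = c • B x y
  op_smul_right : ∀ (x y) (a : A), B x (MulOpposite.op a • y) = B x y * a
  star_apply : ∀ x y, star (B x y) = B y x

theorem IsHermitianForm.op_smul_left {A M : Type*} [Ring A] [StarRing A] [Algebra ℂ A]
    [AddCommGroup M] [Module ℂ M] [Module Aᵐᵒᵖ M] {B : M → M → A} (hB : IsHermitianForm B)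
    (x y : M) (a : A) : B (MulOpposite.op a • x) y = star a * B x y := by
  rw [← hB.star_apply, hB.op_smul_right, star_mul, hB.star_apply]

/-- The inner product `⟨a, b⟩ = a* b` of a `*`-algebra, as a module over itself. -/
def selfForm {A : Type*} [Mul A] [Star A] (a b : A) : A := star a * b

theorem isHermitianForm_selfForm {A : Type*} [Ring A] [StarRing A] [Algebra ℂ A] :
    IsHermitianForm (selfForm : A → A → A) where
  add_right _ _ _ := mul_add _ _ _
  smul_right _ _ _ := mul_smul_comm _ _ _
  op_smul_right _ _ _ := (mul_assoc _ _ _).symm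
  star_apply _ _ := by rw [selfForm, star_mul, star_star, selfForm]

section

variable {A ι : Type*} {M : Type v} {J : Type w₁} [Ring A] [Algebra ℂ A] [Preorder ι]
  [IsDirectedOrder ι]
  {H : LocallyHilbertSpace.{_, w} ι} {B : M → M → A} {φ : J → J → A →ₗ[ℂ] Op H H}

/-- The inner products `⟨x ⊗ ξ e_i, y ⊗ η e_j⟩ = ⟨ξ, φ_ij(⟨x, y⟩) η⟩` of the elementary tensors in
the interior tensor product of `M` with `J` copies of `H`. -/
def tensorKernel (B : M → M → A) (φ : J → J → A →ₗ[ℂ] Op H H) :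
    Matrix (M × J × H) (M × J × H) ℂ :=
  Matrix.of fun g h => ⟪g.2.2, φ g.2.1 h.2.1 (B g.1 h.1) h.2.2⟫_ℂ

/-- `X` is the interior tensor product of `M` with `J` copies of `H`, and `k (x, i, ξ)` is the
elementary tensor `x ⊗ ξ e_i`. The form `⟨x, y⟩` is `B x y`. -/
structure IsInteriorTensor (B : M → M → A) (φ : J → J → A →ₗ[ℂ] Op H H)
    {X : LocallyHilbertSpace.{_, w₂} ι} (k : M × J × H → X) : Prop where
  generates : Generates X (fun α => {g : M × J × H | g.2.2 ∈ H.level α}) k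
  inner_eq : ∀ g h, ⟪k g, k h⟫_ℂ = ⟪g.2.2, φ g.2.1 h.2.1 (B g.1 h.1) h.2.2⟫_ℂ

namespace IsInteriorTensor

variable {X : LocallyHilbertSpace.{_, w₂} ι} {k : M × J × H → X} (hk : IsInteriorTensor B φ k)

include hk

theorem eq_add_left {x y z : M} (h : ∀ w, B w z = B w x + B w y) (u : J × H) :
    k (z, u) = k (x, u) + k (y, u) := hk.generates.eq_of_inner fun g => by
  rw [inner_add_right, hk.inner_eq, hk.inner_eq, hk.inner_eq, h, map_add]
  exact inner_add_right _ _ _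

theorem eq_smul_left {x z : M} {c : ℂ} (h : ∀ w, B w z = c • B w x) (u : J × H) :
    k (z, u) = c • k (x, u) := hk.generates.eq_of_inner fun g => by
  rw [inner_smul_right, hk.inner_eq, hk.inner_eq, h, map_smul]
  exact inner_smul_right _ _ _

theorem add_right (x : M) (i : J) (ξ η : H) : k (x, i, ξ + η) = k (x, i, ξ) + k (x, i, η) :=
  hk.generates.eq_of_inner fun g => by
    rw [inner_add_right, hk.inner_eq, hk.inner_eq, hk.inner_eq, map_add]
    exact inner_add_right _ _ _

theorem smul_right (x : M) (i : J) (c : ℂ) (ξ : H) : k (x, i, c • ξ) = c • k (x, i, ξ) :=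
  hk.generates.eq_of_inner fun g => by
    rw [inner_smul_right, hk.inner_eq, hk.inner_eq, map_smul]
    exact inner_smul_right _ _ _

theorem norm_le (x : M) (i : J) {α : ι} {ξ : H} (hξ : ξ ∈ H.level α) :
    ‖k (x, i, ξ)‖ ≤ √‖(φ i i (B x x)).restrict α‖ * ‖ξ‖ := by
  refine le_of_sq_le_sq ?_ (mul_nonneg (Real.sqrt_nonneg _) (norm_nonneg _))
  calc ‖k (x, i, ξ)‖ ^ 2 = RCLike.re ⟪ξ, φ i i (B x x) ξ⟫_ℂ := by
        rw [← inner_self_eq_norm_sq (𝕜 := ℂ), hk.inner_eq]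
    _ ≤ ‖ξ‖ * ‖φ i i (B x x) ξ‖ := (RCLike.re_le_norm _).trans (norm_inner_le_norm _ _)
    _ ≤ ‖ξ‖ * (‖(φ i i (B x x)).restrict α‖ * ‖ξ‖) := by
        gcongr
        exact Op.norm_apply_le_restrict _ hξ
    _ = (√‖(φ i i (B x x)).restrict α‖ * ‖ξ‖) ^ 2 := by
        rw [mul_pow, Real.sq_sqrt (ContinuousLinearMap.opNorm_nonneg _)]
        ring

/-- The creation operator `ξ ↦ x ⊗ ξ e_i`. -/
def creation (x : M) (i : J) : Op H X :=
  Op.ofDual hk.generates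
    { toFun := fun ξ => k (x, i, ξ)
      map_add' := hk.add_right x i
      map_smul' := hk.smul_right x i }
    (fun g => (φ g.2.1 i (B g.1 x)).adjoint g.2.2) (fun _ _ hξ => hk.generates.mem_level hξ)
    (fun _ => ⟨_, fun _ hξ => hk.norm_le x i hξ⟩) (fun _ _ hg => Op.map_mem _ hg)
    fun g ξ => by
      rw [Op.adjoint_inner_left]
      exact hk.inner_eq _ _

theorem creation_apply (x : M) (i : J) (ξ : H) : hk.creation x i ξ = k (x, i, ξ) := rfl

theorem adjoint_creation_comp_creation (x y : M) (i j : J) :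
    (hk.creation x i).adjoint.comp (hk.creation y j) = φ i j (B x y) :=
  Op.ext fun ξ => ext_inner_left ℂ fun η => by
    change ⟪η, (hk.creation x i).adjoint (hk.creation y j ξ)⟫_ℂ = _
    rw [Op.inner_adjoint_right]
    exact hk.inner_eq _ _

end IsInteriorTensor

open scoped ComplexOrder in
theorem exists_isInteriorTensor_of_posSemidef [Nonempty ι] (hφ : (tensorKernel B φ).PosSemidef) :
    ∃ (X : LocallyHilbertSpace.{_, max v w₁ w} ι) (k : M × J × H → X), IsInteriorTensor B φ k := by
  obtain ⟨E, _, _, _, k, hk⟩ := exists_inner_eq_of_posSemidef hφ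
  obtain ⟨X, j, k', hj, hk'⟩ := exists_generates (L := fun _ => ⊤)
    (s := fun α => {g : M × J × H | g.2.2 ∈ H.level α}) k
    (fun α β h g hg => H.level_mono h hg) (fun g => H.exists_mem_level g.2.2)
    (fun _ => isClosed_univ.isComplete) (fun _ _ _ => Submodule.mem_top)
  refine ⟨X, k', hk', fun g h => ?_⟩
  rw [← j.inner_map_map, hj, hj, hk]
  rfl

open scoped ComplexOrder in
theorem IsCompletelyPositive.posSemidef_tensorKernel {A : Type*} [Ring A] [StarRing A]
    [Algebra ℂ A] {n : ℕ} {φ : Fin n → Fin n → A →ₗ[ℂ] Op H H}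
    (hφ : IsCompletelyPositive (entrywiseMap φ)) : (tensorKernel selfForm φ).PosSemidef := by
  refine posSemidef_of_submatrix fun s => ?_
  obtain ⟨N, d, hd⟩ := hφ.exists_gram (J := s) (fun g => g.1.2.1) (fun g => g.1.1)
  have hgram : (tensorKernel selfForm φ).submatrix ((↑) : s → A × Fin n × H) (↑) =
      ∑ ν, Matrix.gram ℂ fun g : s => d ν g g.1.2.2 := by
    ext g h
    rw [Matrix.sum_apply, Matrix.submatrix_apply, tensorKernel, Matrix.of_apply, selfForm, hd,
      Op.sum_apply, inner_sum]
    exact Finset.sum_congr rfl fun ν _ => Op.inner_adjoint_right _ _ _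
  rw [hgram]
  exact Matrix.posSemidef_sum _ fun ν _ => Matrix.posSemidef_gram ℂ _

end

/-! ### Column vectors -/

namespace LocallyHilbertSpace

variable {ι : Type*} [Preorder ι] [IsDirectedOrder ι]

/-- The Hilbert direct sum of copies of `K_α`, inside the direct sum of copies of `K`. -/
def piLevel (K : LocallyHilbertSpace.{_, w₁} ι) (R : Type*) (α : ι) :
    Submodule ℂ (PiLp 2 fun _ : R => (K : Type w₁)) :=
  ⨅ r, (K.level α).comap (PiLp.projₗ 2 (fun _ : R => (K : Type w₁)) r)

theorem mem_piLevel {K : LocallyHilbertSpace.{_, w₁} ι} {R : Type*} {α : ι}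
    {z : PiLp 2 fun _ : R => (K : Type w₁)} :
    z ∈ K.piLevel R α ↔ ∀ r, z r ∈ K.level α :=
  Submodule.mem_iInf _

theorem isComplete_piLevel (K : LocallyHilbertSpace.{_, w₁} ι) (R : Type*) [Finite R] (α : ι) :
    IsComplete (K.piLevel R α : Set (PiLp 2 fun _ : R => (K : Type w₁))) := by
  have := Fintype.ofFinite R
  let f : (PiLp 2 fun _ : R => K.level α) →+ PiLp 2 fun _ : R => (K : Type w₁) :=
    { toFun := fun z => WithLp.toLp 2 fun r => (z r : K)
      map_zero' := rfl
      map_add' := fun _ _ => rfl }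
  have hf : Isometry f := AddMonoidHomClass.isometry_of_norm f fun z => by
    rw [PiLp.norm_eq_of_L2, PiLp.norm_eq_of_L2]
    rfl
  refine (congrArg IsComplete (Set.ext fun z => ?_)).mp hf.isUniformInducing.isComplete_range
  rw [SetLike.mem_coe, mem_piLevel]
  exact ⟨fun ⟨y, hy⟩ r => hy ▸ (y r).2, fun hz => ⟨WithLp.toLp 2 fun r => ⟨z r, hz r⟩, rfl⟩⟩

end LocallyHilbertSpace

section

variable {A M J ι : Type*} {R : Type w₂} [Ring A] [Algebra ℂ A] [Fintype R] [Preorder ι]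
  [IsDirectedOrder ι] {H : LocallyHilbertSpace.{_, w} ι} {K : LocallyHilbertSpace.{_, w₁} ι}
  {B : M → M → A} {φ : J → J → A →ₗ[ℂ] Op H H}

/-- The vector `(Φ_ri(x) ξ)_r` of the Hilbert direct sum of copies of `K`. -/
def columnVector (Φ : R → J → M → Op H K) (g : M × J × H) : PiLp 2 fun _ : R => (K : Type w₁) :=
  WithLp.toLp 2 fun r => Φ r g.2.1 g.1 g.2.2

theorem inner_columnVector {Φ : R → J → M → Op H K}
    (hΦ : ∀ x y i j, ∑ r, (Φ r i x).adjoint.comp (Φ r j y) = φ i j (B x y)) (g h : M × J × H) :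
    ⟪columnVector Φ g, columnVector Φ h⟫_ℂ = ⟪g.2.2, φ g.2.1 h.2.1 (B g.1 h.1) h.2.2⟫_ℂ := by
  rw [← hΦ, Op.sum_apply, inner_sum, PiLp.inner_apply]
  exact Finset.sum_congr rfl fun r _ => (Op.inner_adjoint_right _ _ _).symm

theorem IsInteriorTensor.exists_coordinate {Y : LocallyHilbertSpace ι} {l : M × J × H → Y}
    (hl : IsInteriorTensor B φ l) {Φ : R → J → M → Op H K}
    {j : Y →ₗᵢ[ℂ] PiLp 2 fun _ : R => (K : Type w₁)} (hj : ∀ g, j (l g) = columnVector Φ g)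
    (r : R) : ∃ V : Op Y K, ∀ g, V (l g) = Φ r g.2.1 g.1 g.2.2 := by
  let f : Y →L[ℂ] K := (PiLp.proj 2 (fun _ : R => (K : Type w₁)) r).comp j.toContinuousLinearMap
  have hf : ∀ g, f (l g) = Φ r g.2.1 g.1 g.2.2 := fun g => congrArg (fun z => z r) (hj g)
  have hmem : ∀ α, Y.level α ≤ (K.level α).comap f.toLinearMap := fun α =>
    hl.generates.level_le ((K.isClosed_level α).preimage f.continuous) fun g hg => by
      change f (l g) ∈ K.level α
      rw [hf]
      exact Op.map_mem _ hg
  have hproj : ∀ α, (K.level α).starProjection.comp f = f.comp (Y.level α).starProjection :=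
    fun α => hl.generates.clm_ext fun ⟨x, i, ξ⟩ => by
      change (K.level α).starProjection (f (l (x, i, ξ))) =
        f ((Y.level α).starProjection (hl.creation x i ξ))
      rw [hf, Op.proj_apply, Op.proj_apply, hl.creation_apply, hf]
  exact ⟨⟨f.toLinearMap, fun α _ hz => hmem α hz, fun α => ⟨‖f‖, fun z _ => f.le_opNorm z⟩,
    fun α z => congrArg (fun T : Y →L[ℂ] K => T z) (hproj α)⟩, hf⟩

theorem exists_isInteriorTensor_of_sum_adjoint_comp [Nonempty ι] {Φ : R → J → M → Op H K}
    (hΦ : ∀ x y i j, ∑ r, (Φ r i x).adjoint.comp (Φ r j y) = φ i j (B x y)) :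
    ∃ (Y : LocallyHilbertSpace.{_, max w₁ w₂} ι) (l : M × J × H → Y) (V : R → Op Y K),
      IsInteriorTensor B φ l ∧ ∀ r g, V r (l g) = Φ r g.2.1 g.1 g.2.2 := by
  obtain ⟨Y, j, l, hj, hl⟩ := exists_generates (s := fun α => {g : M × J × H | g.2.2 ∈ H.level α})
    (columnVector Φ) (fun α β h g hg => H.level_mono h hg) (fun g => H.exists_mem_level g.2.2)
    (fun α => K.isComplete_piLevel R α) (fun α g hg => mem_piLevel.mpr fun r => Op.map_mem _ hg)
  have hlφ : IsInteriorTensor B φ l :=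
    ⟨hl, fun g h => by rw [← j.inner_map_map, hj, hj, inner_columnVector hΦ]⟩
  choose V hV using hlφ.exists_coordinate hj
  exact ⟨Y, l, V, hlφ, hV⟩

end

/-! ### Multiplication operators -/

theorem continuous_of_continuous_entrywiseMap {A C : Type*} [Ring A] [Algebra ℂ A]
    [TopologicalSpace A] [Ring C] [Algebra ℂ C] [TopologicalSpace C] {n : ℕ}
    {φ : Fin n → Fin n → A →ₗ[ℂ] C} (h : Continuous (entrywiseMap φ)) (i j : Fin n) :
    Continuous (φ i j) :=
  have hconst : Continuous fun a : A => (Matrix.of fun _ _ => a : Matrix (Fin n) (Fin n) A) :=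
    continuous_matrix fun _ _ => continuous_id
  (h.comp hconst).matrix_elem i j

section

variable {A : Type u} {J ι : Type*} [Ring A] [StarRing A] [Algebra ℂ A] [TopologicalSpace A]
  [Preorder ι] [IsDirectedOrder ι] {H : LocallyHilbertSpace.{_, w} ι} {φ : J → J → A →ₗ[ℂ] Op H H}

theorem exists_norm_restrict_le [Finite J]
    (hA : (𝓝 (0 : A)).HasBasis (fun b : CStarSeminorm A × ℝ => 0 < b.2)
      (fun b => {a : A | b.1 a < b.2}))
    (hφ : ∀ i, Continuous (φ i i)) (α : ι) :
    ∃ (p : CStarSeminorm A) (C : ℝ), ∀ i a, ‖(φ i i a).restrict α‖ ≤ C * p a := by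
  have := Fintype.ofFinite J
  let f : A →ₗ[ℂ] J → H.level α →L[ℂ] H.level α :=
    LinearMap.pi fun i => Op.restrictₗ H H α ∘ₗ φ i i
  have hf : Continuous f := continuous_pi fun i => (Op.continuous_restrictₗ α).comp (hφ i)
  obtain ⟨p, C, hpC⟩ := CStarSeminorm.exists_norm_le_of_continuous
    (F := J → H.level α →L[ℂ] H.level α) hA hf
  exact ⟨p, C, fun i a => (norm_le_pi_norm (f a) i).trans (hpC a)⟩

namespace IsInteriorTensor

variable {X : LocallyHilbertSpace.{_, w₂} ι} {k : A × J × H → X}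
  (hk : IsInteriorTensor selfForm φ k)

include hk

theorem exists_norm_leftMul_le {α : ι} {p : CStarSeminorm A} {C : ℝ}
    (hp : ∀ i a, ‖(φ i i a).restrict α‖ ≤ C * p a) {g : A × J × H} (hg : g.2.2 ∈ H.level α) :
    ∃ D, ∀ a, ‖k (a * g.1, g.2)‖ ≤ D * p a := by
  obtain ⟨b, i, ξ⟩ := g
  refine ⟨√|C| * p b * ‖ξ‖, fun a => ?_⟩
  calc ‖k (a * b, i, ξ)‖ ≤ √‖(φ i i (selfForm (a * b) (a * b))).restrict α‖ * ‖ξ‖ :=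
        hk.norm_le _ _ hg
    _ ≤ √(|C| * p (a * b) ^ 2) * ‖ξ‖ := by
        gcongr
        refine (hp i _).trans ?_
        rw [selfForm, p.star_mul_self]
        gcongr
        exact le_abs_self C
    _ = √|C| * p (a * b) * ‖ξ‖ := by
        rw [Real.sqrt_mul (abs_nonneg C), Real.sqrt_sq (apply_nonneg _ _)]
    _ ≤ √|C| * (p a * p b) * ‖ξ‖ := by
        gcongr
        exact p.mul_le a b
    _ = √|C| * p b * ‖ξ‖ * p a := by ring

theorem norm_linearCombination_leftMul_le {α : ι} {p : CStarSeminorm A} {C : ℝ}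
    (hp : ∀ i a, ‖(φ i i a).restrict α‖ ≤ C * p a)
    (v : {g : A × J × H | g.2.2 ∈ H.level α} →₀ ℂ) (a : A) :
    ‖Finsupp.linearCombination ℂ (fun g => k (a * g.1.1, g.1.2)) v‖ ≤
      p a * ‖Finsupp.linearCombination ℂ (fun g => k g.1) v‖ := by
  let f : A → X := fun a => Finsupp.linearCombination ℂ (fun g => k (a * g.1.1, g.1.2)) v
  have hf : ∀ a b, ⟪f a, f b⟫_ℂ = ⟪f 1, f (star a * b)⟫_ℂ := fun a b =>
    inner_linearCombination_congr (fun g h => by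
      simp only [hk.inner_eq, selfForm, star_mul, one_mul, mul_assoc]) v v
  choose D hD using fun g : {g : A × J × H | g.2.2 ∈ H.level α} =>
    hk.exists_norm_leftMul_le hp g.2
  have hfD : ∀ a, ‖f a‖ ≤ (∑ g ∈ v.support, ‖v g‖ * D g) * p a := fun a => by
    rw [Finset.sum_mul]
    refine norm_sum_le_of_le _ fun g _ => ?_
    refine (norm_smul_le _ _).trans ?_
    rw [mul_assoc]
    exact mul_le_mul_of_nonneg_left (hD g a) (norm_nonneg _)
  simpa only [f, one_mul] using p.norm_le_of_inner_eq hf hfD a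

end IsInteriorTensor

end

/-! ### The representation -/

section

variable {A : Type u} {M J ι : Type*} [Ring A] [StarRing A] [Algebra ℂ A] [TopologicalSpace A]
  [AddCommGroup M] [Module ℂ M] [Module Aᵐᵒᵖ M] [Preorder ι] [IsDirectedOrder ι]
  {H : LocallyHilbertSpace.{_, w} ι} {X : LocallyHilbertSpace.{_, w₁} ι}
  {Y : LocallyHilbertSpace.{_, w₂} ι} {B : M → M → A} {φ : J → J → A →ₗ[ℂ] Op H H}
  {k : A × J × H → X} {l : M × J × H → Y} {p : ι → CStarSeminorm A}

namespace IsInteriorTensor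

theorem norm_linearCombination_op_smul_le (hk : IsInteriorTensor selfForm φ k)
    (hl : IsInteriorTensor B φ l) (hB : IsHermitianForm B) {α : ι} {q : CStarSeminorm A} {C : ℝ}
    (hq : ∀ i a, ‖(φ i i a).restrict α‖ ≤ C * q a)
    (v : {g : A × J × H | g.2.2 ∈ H.level α} →₀ ℂ) (x : M) :
    ‖Finsupp.linearCombination ℂ (fun g => l (MulOpposite.op g.1.1 • x, g.1.2)) v‖ ≤
      √(q (B x x)) * ‖Finsupp.linearCombination ℂ (fun g => k g.1) v‖ := by
  let z : X := Finsupp.linearCombination ℂ (fun g => k g.1) v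
  let z' : X := Finsupp.linearCombination ℂ (fun g => k (B x x * g.1.1, g.1.2)) v
  let y : Y := Finsupp.linearCombination ℂ (fun g => l (MulOpposite.op g.1.1 • x, g.1.2)) v
  have hy : ⟪y, y⟫_ℂ = ⟪z, z'⟫_ℂ := inner_linearCombination_congr (fun g h => by
    simp only [hk.inner_eq, hl.inner_eq, selfForm, hB.op_smul_right, hB.op_smul_left,
      mul_assoc]) v v
  refine le_of_sq_le_sq ?_ (mul_nonneg (Real.sqrt_nonneg _) (norm_nonneg _))
  calc ‖y‖ ^ 2 = RCLike.re ⟪z, z'⟫_ℂ := by rw [← inner_self_eq_norm_sq (𝕜 := ℂ), hy]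
    _ ≤ ‖z‖ * ‖z'‖ := (RCLike.re_le_norm _).trans (norm_inner_le_norm _ _)
    _ ≤ ‖z‖ * (q (B x x) * ‖z‖) := by
        gcongr
        exact hk.norm_linearCombination_leftMul_le hq v _
    _ = (√(q (B x x)) * ‖z‖) ^ 2 := by
        rw [mul_pow, Real.sq_sqrt (apply_nonneg _ _)]
        ring

theorem exists_moduleMap [TopologicalSpace M] [IsTopologicalAddGroup M]
    (hk : IsInteriorTensor selfForm φ k) (hl : IsInteriorTensor B φ l) (hB : IsHermitianForm B)
    (hBc : ∀ q : CStarSeminorm A, Filter.Tendsto (fun x => q (B x x)) (𝓝 0) (𝓝 0))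
    (hp : ∀ α, ∃ C, ∀ i a, ‖(φ i i a).restrict α‖ ≤ C * p α a) :
    ∃ P : M →ₗ[ℂ] Op X Y, Continuous P ∧
      (∀ x g, P x (k g) = l (MulOpposite.op g.1 • x, g.2)) ∧
      ∀ x g, (P x).adjoint (l g) = k (B x g.1, g.2) := by
  choose C hC using hp
  choose P hPk hPl hPp using fun x : M => hk.generates.exists_op hl.generates
    (t := fun g => l (MulOpposite.op g.1 • x, g.2)) (t' := fun g => k (B x g.1, g.2))
    (fun α g hg => hl.generates.mem_level hg) (fun α g hg => hk.generates.mem_level hg)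
    (fun g g' => by rw [hl.inner_eq, hk.inner_eq, selfForm, hB.op_smul_right, hB.star_apply])
    (fun α v => hk.norm_linearCombination_op_smul_le hl hB (hC α) v x)
  let P' : M →ₗ[ℂ] Op X Y :=
    { toFun := P
      map_add' := fun x y => hk.generates.op_ext fun g => by
        change _ = P x (k g) + P y (k g)
        rw [hPk, hPk, hPk]
        refine hl.eq_add_left (fun z => ?_) _
        simp only [hB.op_smul_right, hB.add_right, add_mul]
      map_smul' := fun c x => hk.generates.op_ext fun g => by
        change _ = c • P x (k g)
        rw [hPk, hPk]
        refine hl.eq_smul_left (fun z => ?_) _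
        simp only [hB.op_smul_right, hB.smul_right, smul_mul_assoc] }
  refine ⟨P', Op.continuous_of_norm_apply_le P' (fun α => ?_) fun α x => hPp x α, hPk, hPl⟩
  simpa only [Real.sqrt_zero] using (hBc (p α)).sqrt

theorem exists_representation [IsTopologicalAddGroup A] (hk : IsInteriorTensor selfForm φ k)
    (hp : ∀ α, ∃ C, ∀ i a, ‖(φ i i a).restrict α‖ ≤ C * p α a) :
    ∃ π : A →⋆ₐ[ℂ] Op X X, Continuous π ∧ ∀ a g, π a (k g) = k (a * g.1, g.2) := by
  have hself : ∀ q : CStarSeminorm A, Filter.Tendsto (fun a => q (selfForm a a)) (𝓝 0) (𝓝 0) :=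
    fun q => by
      simpa only [selfForm, q.star_mul_self, map_zero, ne_eq, OfNat.ofNat_ne_zero,
        not_false_eq_true, zero_pow] using (q.continuous_toSeminorm.tendsto 0).pow 2
  obtain ⟨P, hPc, hP, hPadj⟩ := hk.exists_moduleMap hk isHermitianForm_selfForm hself hp
  have hmul : ∀ a b, P (a * b) = P a * P b := fun a b => hk.generates.op_ext fun g => by
    change _ = P a (P b (k g))
    simp only [hP, op_smul_eq_mul, mul_assoc]
  have hone : P 1 = 1 := hk.generates.op_ext fun g => by
    rw [hP, op_smul_eq_mul, one_mul]
    rfl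
  have hstar : ∀ a, P (star a) = (P a).adjoint := fun a => hk.generates.op_ext fun g => by
    rw [hP, hPadj, op_smul_eq_mul, selfForm]
  exact ⟨{ AlgHom.ofLinearMap P hone hmul with map_star' := hstar }, hPc, hP⟩

end IsInteriorTensor

end

section

variable {A : Type u} [Ring A] [StarRing A] [Algebra ℂ A] [StarModule ℂ A] [UniformSpace A]
  [IsUniformAddGroup A] {M : Type v} [AddCommGroup M] [Module ℂ M] [Module Aᵐᵒᵖ M]
  [UniformSpace M] [IsUniformAddGroup M] [HilbertModule A M]

theorem isHermitianForm_inner : IsHermitianForm (inner A : M → M → A) where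
  add_right := HilbertModule.inner_add_right
  smul_right := HilbertModule.inner_smul_right
  op_smul_right := HilbertModule.inner_op_smul_right
  star_apply := HilbertModule.star_inner

theorem tendsto_cstarSeminorm_inner_self (q : CStarSeminorm A) :
    Filter.Tendsto (fun x : M => q (inner A x x)) (𝓝 0) (𝓝 0) := by
  have hsqrt : Filter.Tendsto (fun x : M => √(q (inner A x x))) (𝓝 0) (𝓝 0) := by
    refine (HilbertModule.hasBasis_nhds_zero (A := A)).tendsto_iff Metric.nhds_basis_ball |>.mpr
      fun ε hε => ⟨(q, ε), hε, fun x hx => ?_⟩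
    rw [mem_ball_zero_iff, Real.norm_of_nonneg (Real.sqrt_nonneg _)]
    exact hx
  simpa only [Real.sq_sqrt (apply_nonneg q.toSeminorm _), ne_eq, OfNat.ofNat_ne_zero,
    not_false_eq_true, zero_pow] using hsqrt.pow 2

end

theorem theorem2p2_general {A : Type u} [Ring A] [StarRing A] [Algebra ℂ A] [TopologicalSpace A]
    [IsTopologicalAddGroup A] {M : Type v} [AddCommGroup M] [Module ℂ M] [Module Aᵐᵒᵖ M]
    [TopologicalSpace M] [IsTopologicalAddGroup M] {ι : Type*} [Preorder ι] [IsDirectedOrder ι]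
    {H : LocallyHilbertSpace.{_, w} ι} {K : LocallyHilbertSpace.{_, w₁} ι} {n : ℕ} {R : Type w₂}
    [Fintype R] {B : M → M → A} {φ : Fin n → Fin n → A →ₗ[ℂ] Op H H} {Φ : R → Fin n → M → Op H K}
    (hA : (𝓝 (0 : A)).HasBasis (fun b : CStarSeminorm A × ℝ => 0 < b.2)
      (fun b => {a : A | b.1 a < b.2}))
    (hB : IsHermitianForm B)
    (hBc : ∀ q : CStarSeminorm A, Filter.Tendsto (fun x => q (B x x)) (𝓝 0) (𝓝 0))
    (hφc : ∀ i, Continuous (φ i i)) (hφ : IsCompletelyPositive (entrywiseMap φ))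
    (hΦ : ∀ x y i j, ∑ r, (Φ r i x).adjoint.comp (Φ r j y) = φ i j (B x y)) :
    ∃ (X : LocallyHilbertSpace.{_, max u w} ι) (Y : LocallyHilbertSpace.{_, max w₁ w₂} ι)
      (π : A →⋆ₐ[ℂ] Op X X) (P : M →ₗ[ℂ] Op X Y) (S : Fin n → Op H X) (W : R → Op K Y),
      (Continuous P ∧ Continuous π ∧ ∀ x y, (P x).adjoint.comp (P y) = π (B x y)) ∧
      (∀ i, @Continuous H X H.topology X.topology (S i)) ∧
      (∀ r, @Continuous K Y K.topology Y.topology (W r)) ∧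
      (∀ a i j, φ i j a = (S i).adjoint.comp ((π a).comp (S j))) ∧
      (∀ x r j, Φ r j x = (W r).adjoint.comp ((P x).comp (S j))) ∧
      X.closedSpan {z | ∃ a i ξ, z = π a (S i ξ)} = Set.univ ∧
      Y.closedSpan {z | ∃ x i ξ, z = P x (S i ξ)} = Set.univ := by
  have : Nonempty ι := (H.exists_mem_level 0).nonempty
  obtain ⟨X, k, hk⟩ := exists_isInteriorTensor_of_posSemidef hφ.posSemidef_tensorKernel
  obtain ⟨Y, l, V, hl, hV⟩ := exists_isInteriorTensor_of_sum_adjoint_comp hΦ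
  choose p hp using exists_norm_restrict_le hA hφc
  obtain ⟨π, hπc, hπ⟩ := hk.exists_representation hp
  obtain ⟨P, hPc, hP, hPadj⟩ := hk.exists_moduleMap hl hB hBc hp
  have hπS : ∀ a j, (π a).comp (hk.creation 1 j) = hk.creation a j := fun a j =>
    Op.ext fun ξ => (hπ a (1, j, ξ)).trans (by rw [mul_one]; rfl)
  have hPS : ∀ x j, (P x).comp (hk.creation 1 j) = hl.creation x j := fun x j =>
    Op.ext fun ξ => (hP x (1, j, ξ)).trans (by rw [MulOpposite.op_one, one_smul]; rfl)
  refine ⟨X, Y, π, P, hk.creation 1, fun r => (V r).adjoint,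
    ⟨hPc, hπc, fun x y => hk.generates.op_ext fun g => ?_⟩,
    fun i => Op.continuous_topology _, fun r => Op.continuous_topology _, fun a i j => ?_,
    fun x r j => ?_, ?_, ?_⟩
  · change (P x).adjoint (P y (k g)) = _
    rw [hP, hPadj, hπ, hB.op_smul_right]
  · rw [hπS, hk.adjoint_creation_comp_creation, selfForm, star_one, one_mul]
  · rw [hPS, Op.adjoint_adjoint]
    exact Op.ext fun ξ => (hV r (x, j, ξ)).symm
  · exact hk.generates.closedSpan_eq_univ fun ⟨a, i, ξ⟩ =>
      ⟨a, i, ξ, congrArg (fun T : Op H X => T ξ) (hπS a i).symm⟩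
  · exact hl.generates.closedSpan_eq_univ fun ⟨x, i, ξ⟩ =>
      ⟨x, i, ξ, congrArg (fun T : Op H Y => T ξ) (hPS x i).symm⟩

end

theorem theorem2p2 {A : Type u} [Ring A] [StarRing A] [Algebra ℂ A] [StarModule ℂ A]
    [UniformSpace A] [IsUniformAddGroup A] [LocallyCStarAlgebra A]
    {M : Type v} [AddCommGroup M] [Module ℂ M] [Module Aᵐᵒᵖ M]
    [UniformSpace M] [IsUniformAddGroup M] [HilbertModule A M]
    (H : LocallyHilbertSpace.{u, w} (CStarSeminorm A))
    (K : LocallyHilbertSpace.{u, w₁} (CStarSeminorm A)) (n : ℕ)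
    (φ : Fin n → Fin n → A →ₗ[ℂ] LocallyHilbertSpace.Op H H)
    (Φ : Fin n → Fin n → M →ₗ[ℂ] LocallyHilbertSpace.Op H K)
    (hΦ : IsCompletelyPositiveMatrix φ Φ) :
    ∃ (HΦ : LocallyHilbertSpace.{u, max u w} (CStarSeminorm A))
      (KΦ : LocallyHilbertSpace.{u, w₁} (CStarSeminorm A))
      (πφ : A →⋆ₐ[ℂ] LocallyHilbertSpace.Op HΦ HΦ)
      (πΦ : M →ₗ[ℂ] LocallyHilbertSpace.Op HΦ KΦ)
      (S : Fin n → LocallyHilbertSpace.Op H HΦ)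
      (W : Fin n → LocallyHilbertSpace.Op K KΦ),
      IsRepresentation πΦ πφ ∧
      (∀ i, @Continuous H HΦ H.topology HΦ.topology (S i)) ∧
      (∀ i, @Continuous K KΦ K.topology KΦ.topology (W i)) ∧
      (∀ (a : A) (i j : Fin n), φ i j a = (S i).adjoint.comp ((πφ a).comp (S j))) ∧
      (∀ (x : M) (i j : Fin n), Φ i j x = (W i).adjoint.comp ((πΦ x).comp (S j))) ∧
      HΦ.closedSpan {z | ∃ (a : A) (i : Fin n) (ξ : H), z = πφ a (S i ξ)} = Set.univ ∧
      KΦ.closedSpan {z | ∃ (x : M) (i : Fin n) (ξ : H), z = πΦ x (S i ξ)} = Set.univ := by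
  obtain ⟨X, Y, π, P, S, W, ⟨hP, hπ, hPπ⟩, h⟩ := theorem2p2_general
    LocallyCStarAlgebra.hasBasis_nhds_zero isHermitianForm_inner tendsto_cstarSeminorm_inner_self
    (fun i => continuous_of_continuous_entrywiseMap hΦ.continuous_left i i)
    hΦ.completelyPositive_left hΦ.sum_adjoint_comp
  exact ⟨X, Y, π, P, S, W, ⟨hP, hπ, hPπ⟩, h⟩
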